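/- **Corollary (linear convergence of gradient flow for sigmoid networks).** Let $\sigma(s)=1/(1+e^{-s})$ be the sigmoid, applied componentwise to vectors. Let $f:\mathbb{R}^N\times\mathbb{R}^P\to\mathbb{R}^M$ be $$f(x,\theta)=g_\ell\big(\sigma(\cdots g_2(\sigma(g_1(x,\theta)),\theta)\cdots),\theta\big),$$ where $\ell\ge 1$ and each $g_i:\mathbb{R}^{N_{i-1}}\times\mathbb{R}^P\to\mathbb{R}^{N_i}$ is polynomial in each component, with $N_0=N$, $N_\ell=M$. Fix targets $y_1,\dots,y_n\in\mathbb{R}^M$ and suppose $P\ge nM$. For data $X=(X_1,\dots,X_n)\in(\mathbb{R}^N)^n$ put $L_X(\theta)=\frac12\sum_{j=1}^n\|f(X_j,\theta)-y_j\|^2$, and assume the network is not degenerate in the sense that the gradient $\nabla_\theta L_X(\theta)$ is nonzero for at least one choice of $X$ and $\theta$. Let the initialization $\theta_0\in\mathbb{R}^P$ and the data $X$ be random with a joint law that is absolutely continuous with respect to Lebesgue measure (for instance, independent with absolutely continuous laws). Then, almost surely with respect to $(\theta_0,X)$, for every $T>0$ the gradient flow $$\theta'(t)=-\nabla L_X(\theta(t)),\qquad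 \theta(0)=\theta_0,$$ has a unique solution on $[0,T]$, and there is $\lambda_0>0$ (which may depend on $T$, $\theta_0$ and $X$) such that for all $t\in[0,T]$ $$\|y-F_t\|\le e^{-\lambda_0 t}\,\|y-F_0\|,\qquad\text{equivalently}\qquad L_X(\theta(t))\le e^{-2\lambda_0 t}L_X(\theta(0)),$$ where $F_t=(f(X_1,\theta(t)),\dots,f(X_n,\theta(t)))\in\mathbb{R}^{nM}$ and $y=(y_1,\dots,y_n)\in\mathbb{R}^{nM}$ are the concatenated outputs and targets. -/

import Mathlib

/-- A feed-forward architecture with `P` trainable parameters, input dimension `N` and output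
dimension `M`: a nonempty finite sequence of layers, each of them polynomial in every component
in the layer input (variables `Sum.inl _`) and the full parameter vector (variables
`Sum.inr _`). The widths of the hidden layers are arbitrary. -/
inductive PolyNet (P : ℕ) : ℕ → ℕ → Type
  /-- The last layer; no activation is applied after it. -/
  | output {N M : ℕ} (g : Fin M → MvPolynomial (Fin N ⊕ Fin P) ℝ) : PolyNet P N M
  /-- A layer followed by the activation and then by the rest of the network. -/
  | hidden {N K M : ℕ} (g : Fin K → MvPolynomial (Fin N ⊕ Fin P) ℝ)
      (rest : PolyNet P K M) : PolyNet P N M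

namespace PolyNet

/-- `g_L (σ (⋯ g_2 (σ (g_1 (x, θ)), θ) ⋯), θ)`, with `σ` applied componentwise. -/
noncomputable def eval {P : ℕ} (σ : ℝ → ℝ) (θ : Fin P → ℝ) :
    {N M : ℕ} → PolyNet P N M → (Fin N → ℝ) → Fin M → ℝ
  | _, _, output g, x => fun m => MvPolynomial.eval (Sum.elim x θ) (g m)
  | _, _, hidden g rest, x =>
      eval σ θ rest (fun k => σ (MvPolynomial.eval (Sum.elim x θ) (g k)))

variable {P N M n : ℕ}

/-- The function `f(x, θ)` computed by the network, between Euclidean spaces. -/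
noncomputable def toFun (A : PolyNet P N M) (σ : ℝ → ℝ)
    (x : EuclideanSpace ℝ (Fin N)) (θ : EuclideanSpace ℝ (Fin P)) : EuclideanSpace ℝ (Fin M) :=
  WithLp.toLp 2 (A.eval σ (fun p => θ p) (fun i => x i))

/-- The error `½ ∑ⱼ ‖f(Xⱼ, θ) - yⱼ‖²` on the training data. -/
noncomputable def loss (A : PolyNet P N M) (σ : ℝ → ℝ)
    (X : Fin n → EuclideanSpace ℝ (Fin N)) (y : Fin n → EuclideanSpace ℝ (Fin M))
    (θ : EuclideanSpace ℝ (Fin P)) : ℝ :=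
  (1 / 2 : ℝ) * ∑ j, ‖A.toFun σ (X j) θ - y j‖ ^ 2

/-- The concatenated output vector in `ℝ^{nM}`. -/
noncomputable def outputs (A : PolyNet P N M) (σ : ℝ → ℝ)
    (X : Fin n → EuclideanSpace ℝ (Fin N)) (θ : EuclideanSpace ℝ (Fin P)) :
    EuclideanSpace ℝ (Fin n × Fin M) :=
  WithLp.toLp 2 (fun jm => A.toFun σ (X jm.1) θ jm.2)

/-- `θ` solves the gradient flow `θ' = -∇L(θ)` on `[0, T]` with `θ(0) = θ₀` (one-sided
derivatives at the end points). Values of `θ` outside `[0, T]` play no role. -/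
def IsGradientFlow (A : PolyNet P N M) (σ : ℝ → ℝ)
    (X : Fin n → EuclideanSpace ℝ (Fin N)) (y : Fin n → EuclideanSpace ℝ (Fin M))
    (θ₀ : EuclideanSpace ℝ (Fin P)) (T : ℝ) (θ : ℝ → EuclideanSpace ℝ (Fin P)) : Prop :=
  θ 0 = θ₀ ∧ ∀ t ∈ Set.Icc 0 T,
    HasDerivWithinAt θ (-gradient (A.loss σ X y) (θ t)) (Set.Icc 0 T) t

end PolyNet

/-- The concatenated target vector in `ℝ^{nM}`. -/
noncomputable def concatTargets {n M : ℕ} (y : Fin n → EuclideanSpace ℝ (Fin M)) :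
    EuclideanSpace ℝ (Fin n × Fin M) :=
  WithLp.toLp 2 (fun jm => y jm.1 jm.2)

/-! ### Zero sets of real analytic functions. -/

open MeasureTheory Set Filter Topology

/-! The map `(θ, X) ↦ ∇_θ L_X(θ)` is jointly real analytic and not identically zero, so its zero set
is null (`AnalyticOnNhd.ae_ne_zero`): almost surely the flow starts off the critical set. Since `L ≥
0`, the energy dissipated bounds the length of the trajectory, which excludes blow-up
(`exists_gradientFlow_Icc`). By uniqueness for ODEs the flow reaches no critical point in finite
time, so on the compact `[0, T]` the gradient norm is bounded below and `‖∇L‖² ≥ c L` along the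
trajectory. Hence `L` decays exponentially (`exists_exp_decay_gradientFlow`). -/

theorem AnalyticOnNhd.ae_ne_zero_of_real {F : Type*} [NormedAddCommGroup F] [NormedSpace ℝ F]
    {f : ℝ → F} (hf : AnalyticOnNhd ℝ f univ) {t₀ : ℝ} (h₀ : f t₀ ≠ 0) :
    ∀ᵐ t, f t ≠ 0 := by
  rcases hf.eqOn_zero_or_eventually_ne_zero_of_preconnected isPreconnected_univ with h | h
  · exact absurd (h (mem_univ t₀)) h₀
  · rw [← Measure.restrict_univ (μ := (volume : Measure ℝ))]
    exact ae_restrict_le_codiscreteWithin MeasurableSet.univ h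

/-- Fubini and induction on `d`: for almost every first coordinate `t`, `f` is nonzero at `(t, tail
x₀)`, and then the induction hypothesis applies to the slice at `t`. -/
theorem AnalyticOnNhd.ae_ne_zero_of_pi {F : Type*} [NormedAddCommGroup F] [NormedSpace ℝ F]
    {d : ℕ} {f : (Fin d → ℝ) → F} (hf : AnalyticOnNhd ℝ f univ) {x₀ : Fin d → ℝ}
    (h₀ : f x₀ ≠ 0) : ∀ᵐ x, f x ≠ 0 := by
  induction d with
  | zero => exact Eventually.of_forall fun x => by rwa [Subsingleton.elim x x₀]
  | succ d ih =>
    let e := MeasurableEquiv.piFinSuccAbove (fun _ : Fin (d + 1) => ℝ) 0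
    have he : MeasurePreserving e := volume_preserving_piFinSuccAbove (fun _ => ℝ) 0
    have hsymm (p : ℝ × (Fin d → ℝ)) : e.symm p = Fin.cons p.1 p.2 := by
      ext i
      refine Fin.cases ?_ (fun j => ?_) i <;> simp [e, MeasurableEquiv.piFinSuccAbove]
    have hcons : AnalyticOnNhd ℝ
        (fun p : ℝ × (Fin d → ℝ) => (Fin.cons p.1 p.2 : Fin (d + 1) → ℝ)) univ := by
      refine AnalyticOnNhd.pi fun i => ?_
      refine Fin.cases ?_ (fun j => ?_) i
      · exact fun p _ => by simpa using analyticAt_fst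
      · intro p _
        simp only [Fin.cons_succ]
        exact ((ContinuousLinearMap.proj (R := ℝ) (φ := fun _ : Fin d => ℝ) j).comp
          (ContinuousLinearMap.snd ℝ ℝ (Fin d → ℝ))).analyticAt p
    have hg : AnalyticOnNhd ℝ
        (fun p : ℝ × (Fin d → ℝ) => f (Fin.cons p.1 p.2)) univ :=
      hf.comp hcons (mapsTo_univ _ _)
    have hslice : ∀ᵐ t : ℝ, f (Fin.cons t (Fin.tail x₀)) ≠ 0 := by
      refine AnalyticOnNhd.ae_ne_zero_of_real (t₀ := x₀ 0)
        (f := fun t : ℝ => f (Fin.cons t (Fin.tail x₀))) ?_ (by simpa using h₀)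
      exact fun t _ => (hg (t, Fin.tail x₀) (mem_univ _)).comp₂ analyticAt_id analyticAt_const
    have hprod : ∀ᵐ p : ℝ × (Fin d → ℝ), f (Fin.cons p.1 p.2) ≠ 0 := by
      rw [ae_iff, Measure.volume_eq_prod, Measure.measure_prod_null]
      · filter_upwards [hslice] with t ht
        refine ae_iff.1 (ih (f := fun v => f (Fin.cons t v)) (fun v _ => ?_) ht)
        exact (hg (t, v) (mem_univ _)).comp₂ analyticAt_const analyticAt_id
      · have hcont := hg.continuousOn
        rw [continuousOn_univ] at hcont
        have hset : {p : ℝ × (Fin d → ℝ) | ¬f (Fin.cons p.1 p.2) ≠ 0} =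
            (fun p : ℝ × (Fin d → ℝ) => f (Fin.cons p.1 p.2)) ⁻¹' {0} := by
          ext p
          simp
        rw [hset]
        exact (isClosed_singleton.preimage hcont).measurableSet
    filter_upwards [he.quasiMeasurePreserving.ae hprod] with x hx
    rwa [← hsymm, e.symm_apply_apply] at hx

/-- The zero set of a nonzero real analytic function on a finite-dimensional space is null. -/
theorem AnalyticOnNhd.ae_ne_zero {E F : Type*} [NormedAddCommGroup E] [NormedSpace ℝ E]
    [FiniteDimensional ℝ E] [MeasurableSpace E] [BorelSpace E] [NormedAddCommGroup F]
    [NormedSpace ℝ F] (μ : Measure E) [μ.IsAddHaarMeasure] {f : E → F}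
    (hf : AnalyticOnNhd ℝ f univ) {x₀ : E} (h₀ : f x₀ ≠ 0) : ∀ᵐ x ∂μ, f x ≠ 0 := by
  let e : E ≃L[ℝ] (Fin (Module.finrank ℝ E) → ℝ) :=
    ContinuousLinearEquiv.ofFinrankEq (by simp)
  have hpi : ∀ᵐ v, f (e.symm v) ≠ 0 := by
    refine AnalyticOnNhd.ae_ne_zero_of_pi (f := fun v => f (e.symm v)) (x₀ := e x₀) ?_
      (by simpa using h₀)
    exact hf.comp (fun v _ => e.symm.analyticAt v) (mapsTo_univ _ _)
  have : (μ.map e).IsAddHaarMeasure := e.isAddHaarMeasure_map μ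
  have hac : μ.map e ≪ volume := Measure.absolutelyContinuous_isAddHaarMeasure _ _
  have := ae_of_ae_map e.continuous.measurable.aemeasurable (hac.ae_le hpi)
  simpa using this

/-! ### Analyticity of the loss and its gradient. -/

namespace PolyNet

variable {P N M n : ℕ}

theorem analyticAt_eval (σ : ℝ → ℝ) (hσ : ∀ s, AnalyticAt ℝ σ s) {E : Type*}
    [NormedAddCommGroup E] [NormedSpace ℝ E] {z : E} {θ : E → Fin P → ℝ}
    (hθ : ∀ p, AnalyticAt ℝ (fun w => θ w p) z) (A : PolyNet P N M) {x : E → Fin N → ℝ}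
    (hx : ∀ i, AnalyticAt ℝ (fun w => x w i) z) (m : Fin M) :
    AnalyticAt ℝ (fun w => A.eval σ (θ w) (x w) m) z := by
  have key {N : ℕ} {x : E → Fin N → ℝ} (hx : ∀ i, AnalyticAt ℝ (fun w => x w i) z)
      (q : MvPolynomial (Fin N ⊕ Fin P) ℝ) :
      AnalyticAt ℝ (fun w => MvPolynomial.eval (Sum.elim (x w) (θ w)) q) z := by
    simp only [← MvPolynomial.coe_aeval_eq_eval]
    refine AnalyticAt.aeval_mvPolynomial (f := fun w => Sum.elim (x w) (θ w)) ?_ q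
    rintro (i | p)
    · exact hx i
    · exact hθ p
  induction A with
  | output g => exact key hx (g m)
  | hidden g rest ih =>
    exact ih (x := fun w k => σ (MvPolynomial.eval (Sum.elim (x w) (θ w)) (g k)))
      (fun k => (hσ _).fun_comp (key hx (g k))) m

theorem loss_eq_norm_sq (A : PolyNet P N M) (σ : ℝ → ℝ)
    (X : Fin n → EuclideanSpace ℝ (Fin N)) (y : Fin n → EuclideanSpace ℝ (Fin M))
    (θ : EuclideanSpace ℝ (Fin P)) :
    A.loss σ X y θ = (1 / 2 : ℝ) * ‖concatTargets y - A.outputs σ X θ‖ ^ 2 := by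
  simp only [loss, EuclideanSpace.norm_sq_eq, concatTargets, outputs, Fintype.sum_prod_type]
  congr 1
  refine Finset.sum_congr rfl fun j _ => Finset.sum_congr rfl fun m _ => ?_
  rw [← norm_neg]
  simp

theorem loss_nonneg (A : PolyNet P N M) (σ : ℝ → ℝ)
    (X : Fin n → EuclideanSpace ℝ (Fin N)) (y : Fin n → EuclideanSpace ℝ (Fin M))
    (θ : EuclideanSpace ℝ (Fin P)) : 0 ≤ A.loss σ X y θ := by
  rw [loss_eq_norm_sq]
  positivity

theorem analyticOnNhd_loss (A : PolyNet P N M) {σ : ℝ → ℝ} (hσ : ∀ s, AnalyticAt ℝ σ s)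
    (y : Fin n → EuclideanSpace ℝ (Fin M)) :
    AnalyticOnNhd ℝ (fun ω : EuclideanSpace ℝ (Fin P) × (Fin n → EuclideanSpace ℝ (Fin N)) =>
      A.loss σ ω.2 y ω.1) univ := by
  intro z _
  simp only [loss, EuclideanSpace.norm_sq_eq, Real.norm_eq_abs, sq_abs, PiLp.sub_apply, toFun]
  refine analyticAt_const.mul (Finset.analyticAt_fun_sum _ fun j _ =>
    Finset.analyticAt_fun_sum _ fun m _ => AnalyticAt.pow (AnalyticAt.sub ?_ analyticAt_const) 2)
  refine analyticAt_eval σ hσ (fun p => ?_) A (fun i => ?_) m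
  · exact ((EuclideanSpace.proj p : EuclideanSpace ℝ (Fin P) →L[ℝ] ℝ).comp
      (ContinuousLinearMap.fst ℝ _ _)).analyticAt z
  · exact ((EuclideanSpace.proj i : EuclideanSpace ℝ (Fin N) →L[ℝ] ℝ).comp
      ((ContinuousLinearMap.proj (R := ℝ) (φ := fun _ : Fin n => EuclideanSpace ℝ (Fin N)) j).comp
        (ContinuousLinearMap.snd ℝ _ _))).analyticAt z

end PolyNet

/-- The partial gradient is the full derivative followed by two continuous linear maps: restriction
to `E × 0` and the Riesz isomorphism. -/
theorem AnalyticOnNhd.gradient_left {E G : Type*} [NormedAddCommGroup E] [InnerProductSpace ℝ E]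
    [CompleteSpace E] [NormedAddCommGroup G] [NormedSpace ℝ G] {f : E × G → ℝ}
    (hf : AnalyticOnNhd ℝ f univ) :
    AnalyticOnNhd ℝ (fun ω : E × G => gradient (fun x => f (x, ω.2)) ω.1) univ := by
  have hpartial (ω : E × G) : gradient (fun x => f (x, ω.2)) ω.1 =
      (InnerProductSpace.toDual ℝ E).symm
        ((ContinuousLinearMap.compL ℝ E (E × G) ℝ).flip (ContinuousLinearMap.inl ℝ E G)
          (fderiv ℝ f ω)) := by
    have h : HasFDerivAt (fun x => f (x, ω.2))
        ((fderiv ℝ f ω).comp (ContinuousLinearMap.inl ℝ E G)) ω.1 :=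
      (hf ω (mem_univ _)).differentiableAt.hasFDerivAt.comp ω.1 (hasFDerivAt_prodMk_left ω.1 ω.2)
    simp only [gradient, h.fderiv]
    rfl
  simp only [hpartial]
  intro ω _
  have h1 := (((ContinuousLinearMap.compL ℝ E (E × G) ℝ).flip
    (ContinuousLinearMap.inl ℝ E G)).analyticAt (fderiv ℝ f ω)).fun_comp
    (hf.fderiv ω (mem_univ _))
  exact (((InnerProductSpace.toDual ℝ E).symm.toContinuousLinearEquiv : _ ≃L[ℝ] E).analyticAt
    _).fun_comp h1

instance isAddHaarMeasure_volume_prod_pi {P N n : ℕ} :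
    (volume : Measure (EuclideanSpace ℝ (Fin P) ×
      (Fin n → EuclideanSpace ℝ (Fin N)))).IsAddHaarMeasure := by
  have : (volume : Measure (Fin n → EuclideanSpace ℝ (Fin N))).IsAddHaarMeasure :=
    inferInstanceAs (Measure.pi fun _ => volume).IsAddHaarMeasure
  exact Measure.prod.instIsAddHaarMeasure volume volume

/-! ### Gradient flows on compact intervals. -/

section Flow

variable {E : Type*} [NormedAddCommGroup E]

/-- A bounded, globally Lipschitz autonomous vector field has integral curves on `[0, T]`. -/
theorem LipschitzWith.exists_integralCurve_Icc [NormedSpace ℝ E] [CompleteSpace E] {v : E → E}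
    {K : NNReal} (hv : LipschitzWith K v) {C : NNReal} (hC : ∀ x, ‖v x‖ ≤ C) (x₀ : E) {T : ℝ}
    (hT : 0 ≤ T) :
    ∃ γ : ℝ → E, γ 0 = x₀ ∧ ∀ t ∈ Icc 0 T, HasDerivWithinAt γ (v (γ t)) (Icc 0 T) t := by
  have hPL : IsPicardLindelof (fun _ => v) (⟨0, le_rfl, hT⟩ : Icc 0 T) x₀ (C * T.toNNReal) 0 C K :=
    .of_time_independent (fun x _ => hC x) hv.lipschitzOnWith (by simp [hT])
  exact hPL.exists_eq_forall_mem_Icc_hasDerivWithinAt₀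

theorem HasDerivWithinAt.Ici_of_Icc {F : Type*} [NormedAddCommGroup F] [NormedSpace ℝ F]
    {α : ℝ → F} {α' : F} {a b t : ℝ} (ht : t ∈ Ico a b)
    (hα : HasDerivWithinAt α α' (Icc a b) t) : HasDerivWithinAt α α' (Ici t) t :=
  hα.mono_of_mem_nhdsWithin (mem_of_superset (Icc_mem_nhdsGE ht.2) (Icc_subset_Icc_left ht.1))

theorem HasDerivWithinAt.Iic_of_Icc {F : Type*} [NormedAddCommGroup F] [NormedSpace ℝ F]
    {α : ℝ → F} {α' : F} {a b t : ℝ} (ht : t ∈ Ioc a b)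
    (hα : HasDerivWithinAt α α' (Icc a b) t) : HasDerivWithinAt α α' (Iic t) t :=
  hα.mono_of_mem_nhdsWithin (mem_of_superset (Icc_mem_nhdsLE ht.1) (Icc_subset_Icc_right ht.2))

/-- Integral curves of a `C¹` vector field on `[0, T]` agree if they agree at one time. -/
theorem integralCurve_Icc_unique [NormedSpace ℝ E] [FiniteDimensional ℝ E] {v : E → E}
    (hv : ContDiff ℝ 1 v) {T : ℝ} {γ δ : ℝ → E}
    (hγ : ∀ t ∈ Icc 0 T, HasDerivWithinAt γ (v (γ t)) (Icc 0 T) t)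
    (hδ : ∀ t ∈ Icc 0 T, HasDerivWithinAt δ (v (δ t)) (Icc 0 T) t) {s : ℝ} (hs : s ∈ Icc 0 T)
    (h : γ s = δ s) : EqOn γ δ (Icc 0 T) := by
  have hγc : ContinuousOn γ (Icc 0 T) := HasDerivWithinAt.continuousOn hγ
  have hδc : ContinuousOn δ (Icc 0 T) := HasDerivWithinAt.continuousOn hδ
  have hcpt : IsCompact (γ '' Icc 0 T ∪ δ '' Icc 0 T) :=
    (isCompact_Icc.image_of_continuousOn hγc).union (isCompact_Icc.image_of_continuousOn hδc)
  -- A `C¹` field is Lipschitz on a ball containing both compact trajectories.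
  obtain ⟨R, hR⟩ := hcpt.isBounded.subset_closedBall (0 : E)
  obtain ⟨K, hK⟩ := (hv.contDiffOn (s := Metric.closedBall 0 R)).exists_lipschitzOnWith one_ne_zero
    (convex_closedBall _ _) (isCompact_closedBall _ _)
  have hγR : ∀ t ∈ Icc 0 T, γ t ∈ Metric.closedBall 0 R :=
    fun t ht => hR (.inl (mem_image_of_mem _ ht))
  have hδR : ∀ t ∈ Icc 0 T, δ t ∈ Metric.closedBall 0 R :=
    fun t ht => hR (.inr (mem_image_of_mem _ ht))
  have hright {α : ℝ → E} (hα : ∀ t ∈ Icc 0 T, HasDerivWithinAt α (v (α t)) (Icc 0 T) t) :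
      ∀ t ∈ Ico s T, HasDerivWithinAt α (v (α t)) (Ici t) t := fun t ht =>
    (hα t ⟨hs.1.trans ht.1, ht.2.le⟩).Ici_of_Icc ⟨hs.1.trans ht.1, ht.2⟩
  have hleft {α : ℝ → E} (hα : ∀ t ∈ Icc 0 T, HasDerivWithinAt α (v (α t)) (Icc 0 T) t) :
      ∀ t ∈ Ioc 0 s, HasDerivWithinAt α (v (α t)) (Iic t) t := fun t ht =>
    (hα t ⟨ht.1.le, ht.2.trans hs.2⟩).Iic_of_Icc ⟨ht.1, ht.2.trans hs.2⟩
  have h1 : EqOn γ δ (Icc 0 s) :=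
    ODE_solution_unique_of_mem_Icc_left (v := fun _ => v) (s := fun _ => Metric.closedBall 0 R)
      (K := K) (fun _ _ => hK) (hγc.mono (Icc_subset_Icc_right hs.2)) (hleft hγ)
      (fun t ht => hγR t ⟨ht.1.le, ht.2.trans hs.2⟩) (hδc.mono (Icc_subset_Icc_right hs.2))
      (hleft hδ) (fun t ht => hδR t ⟨ht.1.le, ht.2.trans hs.2⟩) h
  have h2 : EqOn γ δ (Icc s T) :=
    ODE_solution_unique_of_mem_Icc_right (v := fun _ => v) (s := fun _ => Metric.closedBall 0 R)
      (K := K) (fun _ _ => hK) (hγc.mono (Icc_subset_Icc_left hs.1)) (hright hγ)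
      (fun t ht => hγR t ⟨hs.1.trans ht.1, ht.2.le⟩) (hδc.mono (Icc_subset_Icc_left hs.1))
      (hright hδ) (fun t ht => hδR t ⟨hs.1.trans ht.1, ht.2.le⟩) h
  rw [← Icc_union_Icc_eq_Icc hs.1 hs.2]
  exact h1.union h2

variable [InnerProductSpace ℝ E] [FiniteDimensional ℝ E]

theorem contDiff_gradient {f : E → ℝ} {m k : WithTop ℕ∞} (hf : ContDiff ℝ k f) (hmk : m + 1 ≤ k) :
    ContDiff ℝ m (gradient f) :=
  ((InnerProductSpace.toDual ℝ E).symm.toContinuousLinearEquiv : _ ≃L[ℝ] E).contDiff.comp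
    (hf.fderiv_right hmk)

theorem hasDerivWithinAt_comp_curve {f : E → ℝ} {γ : ℝ → E} {γ' : E}
    {s : Set ℝ} {t : ℝ} (hf : DifferentiableAt ℝ f (γ t)) (hγ : HasDerivWithinAt γ γ' s t) :
    HasDerivWithinAt (fun τ => f (γ τ)) (inner ℝ (gradient f (γ t)) γ') s t := by
  have := hf.hasGradientAt.hasFDerivAt.comp_hasDerivWithinAt t hγ
  rw [InnerProductSpace.toDual_apply_apply] at this
  exact this

/-- The gradient flow of a nonnegative `C²` function exists for all times. -/
theorem exists_gradientFlow_Icc {f : E → ℝ} (hf : ContDiff ℝ 2 f) (hf0 : ∀ x, 0 ≤ f x)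
    (x₀ : E) {T : ℝ} (hT : 0 ≤ T) :
    ∃ γ : ℝ → E, γ 0 = x₀ ∧
      ∀ t ∈ Icc 0 T, HasDerivWithinAt γ (-gradient f (γ t)) (Icc 0 T) t := by
  -- Integrating `‖∇f‖ ≤ (1 + ‖∇f‖²) / 2` bounds the length by `(T + f x₀) / 2`. So the flow of the
  -- field cut off by `χ` stays where `χ = 1`.
  let R : ℝ := (T + f x₀) / 2 + 1
  have hR : 0 < R := by have := hf0 x₀; positivity
  let χ : ContDiffBump x₀ := ⟨R, R + 1, hR, by linarith⟩
  let v : E → E := fun x => χ x • -gradient f x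
  have hgrad : ContDiff ℝ 1 (gradient f) := contDiff_gradient hf (by norm_num [one_add_one_eq_two])
  have hvs : HasCompactSupport v := χ.hasCompactSupport.smul_right
  have hvd : ContDiff ℝ 1 v := χ.contDiff.smul hgrad.neg
  obtain ⟨C, hC⟩ := hvs.exists_bound_of_continuous hvd.continuous
  obtain ⟨K, hK⟩ := hvd.lipschitzWith_of_hasCompactSupport hvs one_ne_zero
  obtain ⟨γ, hγ0, hγ⟩ := hK.exists_integralCurve_Icc (C := C.toNNReal)
    (fun x => (hC x).trans (Real.le_coe_toNNReal C)) x₀ hT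
  have hdiff : Differentiable ℝ f := hf.differentiable two_ne_zero
  have hB : ∀ t ∈ Icc 0 T, HasDerivWithinAt (fun τ => (τ + f x₀ - f (γ τ)) / 2)
      ((1 - inner ℝ (gradient f (γ t)) (v (γ t))) / 2) (Icc 0 T) t := fun t ht =>
    (((hasDerivWithinAt_id t _).add_const _).sub
      (hasDerivWithinAt_comp_curve (hdiff _) (hγ t ht))).div_const 2
  -- As `0 ≤ χ ≤ 1`, the estimate survives the cutoff: `χ‖∇f‖ ≤ (1 + χ‖∇f‖²) / 2`.
  have hbound : ∀ x, ‖v x‖ ≤ (1 - inner ℝ (gradient f x) (v x)) / 2 := by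
    intro x
    have h0 : 0 ≤ χ x := χ.nonneg
    have h1 : χ x ≤ 1 := χ.le_one
    simp only [v, smul_neg, norm_neg, inner_neg_right, inner_smul_right, norm_smul,
      real_inner_self_eq_norm_sq, Real.norm_of_nonneg h0]
    nlinarith [mul_nonneg h0 (sq_nonneg (‖gradient f x‖ - 1))]
  have hnear : ∀ t ∈ Icc 0 T, γ t ∈ Metric.closedBall x₀ R := by
    intro t ht
    have := image_norm_le_of_norm_deriv_right_le_deriv_boundary' (f := fun τ => γ τ - x₀)
      (f' := fun τ => v (γ τ)) (a := 0) (b := T)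
      (HasDerivWithinAt.continuousOn fun t ht => (hγ t ht).sub_const x₀)
      (fun t ht => HasDerivWithinAt.Ici_of_Icc ht ((hγ t ⟨ht.1, ht.2.le⟩).sub_const x₀))
      (B := fun τ => (τ + f x₀ - f (γ τ)) / 2) (by simp [hγ0])
      (HasDerivWithinAt.continuousOn hB) (fun t ht => HasDerivWithinAt.Ici_of_Icc ht (hB t ⟨ht.1, ht.2.le⟩))
      (fun t _ => hbound (γ t)) ht
    rw [mem_closedBall_iff_norm]
    have := hf0 (γ t)
    have := ht.2
    simp only [R] at *
    linarith
  refine ⟨γ, hγ0, fun t ht => ?_⟩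
  have h := hγ t ht
  simpa only [v, χ.one_of_mem_closedBall (hnear t ht), one_smul] using h

/-- Along a gradient flow on a compact interval that does not start at a critical point, a
nonnegative function decays exponentially. -/
theorem exists_exp_decay_gradientFlow {f : E → ℝ} (hf : ContDiff ℝ 2 f)
    (hf0 : ∀ x, 0 ≤ f x) {T : ℝ} (hT : 0 ≤ T) {γ : ℝ → E}
    (hγ : ∀ t ∈ Icc 0 T, HasDerivWithinAt γ (-gradient f (γ t)) (Icc 0 T) t)
    (h0 : gradient f (γ 0) ≠ 0) :
    ∃ c : ℝ, 0 < c ∧ ∀ t ∈ Icc 0 T, f (γ t) ≤ Real.exp (-c * t) * f (γ 0) := by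
  have hgrad : ContDiff ℝ 1 (gradient f) := contDiff_gradient hf (by norm_num [one_add_one_eq_two])
  have hγc : ContinuousOn γ (Icc 0 T) := HasDerivWithinAt.continuousOn hγ
  have hne : (Icc (0 : ℝ) T).Nonempty := nonempty_Icc.2 hT
  -- At a critical point the constant curve is also a solution; uniqueness backwards in time would
  -- make `γ 0` critical.
  have hcrit : ∀ t ∈ Icc 0 T, gradient f (γ t) ≠ 0 := by
    intro t ht hzero
    have := integralCurve_Icc_unique hgrad.neg (δ := fun _ => γ t) hγ
      (fun s _ => by simpa [hzero] using hasDerivWithinAt_const s (Icc 0 T) (γ t)) ht rfl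
      (left_mem_Icc.2 hT)
    exact h0 (this ▸ hzero)
  obtain ⟨a, ha, hamin⟩ := isCompact_Icc.exists_isMinOn hne
    ((hgrad.continuous.comp_continuousOn hγc).norm)
  obtain ⟨b, hb, hbmax⟩ := isCompact_Icc.exists_isMaxOn hne
    (hf.continuous.comp_continuousOn hγc)
  have hpos : 0 < ‖gradient f (γ a)‖ := norm_pos_iff.2 (hcrit a ha)
  have hfb : 0 < f (γ b) + 1 := by linarith [hf0 (γ b)]
  -- Minimum of `‖∇f‖²` over maximum of `f` along the curve; the `+ 1` keeps the denominator
  -- positive.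
  let c : ℝ := ‖gradient f (γ a)‖ ^ 2 / (f (γ b) + 1)
  have hc : 0 < c := by positivity
  refine ⟨c, hc, fun t ht => ?_⟩
  have hderiv : ∀ t ∈ Icc 0 T, HasDerivWithinAt (fun τ => Real.exp (c * τ) * f (γ τ))
      (Real.exp (c * t) * (c * f (γ t) - ‖gradient f (γ t)‖ ^ 2)) (Icc 0 T) t := by
    intro t ht
    have h1 : HasDerivWithinAt (fun τ => Real.exp (c * τ)) (Real.exp (c * t) * (c * 1))
        (Icc 0 T) t := (((hasDerivAt_id t).const_mul c).exp).hasDerivWithinAt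
    have h2 := hasDerivWithinAt_comp_curve (hf.differentiable two_ne_zero (γ t)) (hγ t ht)
    refine (h1.mul h2).congr_deriv ?_
    rw [inner_neg_right, real_inner_self_eq_norm_sq]
    ring
  have hanti : AntitoneOn (fun τ => Real.exp (c * τ) * f (γ τ)) (Icc 0 T) := by
    refine antitoneOn_of_hasDerivWithinAt_nonpos (convex_Icc 0 T)
      (HasDerivWithinAt.continuousOn hderiv)
      (fun t ht => (hderiv t (interior_subset ht)).mono interior_subset) fun t ht => ?_
    have ht' := interior_subset ht
    refine mul_nonpos_of_nonneg_of_nonpos (Real.exp_pos _).le (sub_nonpos.2 ?_)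
    calc c * f (γ t) ≤ c * (f (γ b) + 1) := by
          have : f (γ t) ≤ f (γ b) := hbmax ht'
          gcongr
          linarith
      _ = ‖gradient f (γ a)‖ ^ 2 := div_mul_cancel₀ _ hfb.ne'
      _ ≤ _ := by
          have : ‖gradient f (γ a)‖ ≤ ‖gradient f (γ t)‖ := hamin ht'
          gcongr
  have h := hanti (left_mem_Icc.2 hT) ht ht.1
  simp only [mul_zero, Real.exp_zero, one_mul] at h
  calc f (γ t) = Real.exp (-c * t) * (Real.exp (c * t) * f (γ t)) := by
        rw [← mul_assoc, ← Real.exp_add]; simp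
    _ ≤ _ := by gcongr

end Flow

theorem mainTheorem5 {P N M n : ℕ} (A : PolyNet P N M) (hP : n * M ≤ P)
    (y : Fin n → EuclideanSpace ℝ (Fin M))
    (hL : ∃ (X : Fin n → EuclideanSpace ℝ (Fin N)) (θ : EuclideanSpace ℝ (Fin P)),
      gradient (A.loss Real.sigmoid X y) θ ≠ 0)
    (μ : MeasureTheory.Measure
      (EuclideanSpace ℝ (Fin P) × (Fin n → EuclideanSpace ℝ (Fin N))))
    [MeasureTheory.IsProbabilityMeasure μ]
    (hμ : MeasureTheory.Measure.AbsolutelyContinuous μ MeasureTheory.volume) :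
    ∀ᵐ ω ∂μ, ∀ T : ℝ, 0 < T →
      ∃ θ : ℝ → EuclideanSpace ℝ (Fin P),
        A.IsGradientFlow Real.sigmoid ω.2 y ω.1 T θ ∧
        (∀ θ' : ℝ → EuclideanSpace ℝ (Fin P),
          A.IsGradientFlow Real.sigmoid ω.2 y ω.1 T θ' → Set.EqOn θ' θ (Set.Icc 0 T)) ∧
        ∃ lam : ℝ, 0 < lam ∧ ∀ t ∈ Set.Icc 0 T,
          ‖concatTargets y - A.outputs Real.sigmoid ω.2 (θ t)‖
              ≤ Real.exp (-lam * t) * ‖concatTargets y - A.outputs Real.sigmoid ω.2 (θ 0)‖ ∧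
          A.loss Real.sigmoid ω.2 y (θ t)
              ≤ Real.exp (-2 * lam * t) * A.loss Real.sigmoid ω.2 y (θ 0) := by
  have hloss := A.analyticOnNhd_loss (fun _ => analyticAt_sigmoid) y
  obtain ⟨X₀, θ₀, h₀⟩ := hL
  have hae := hloss.gradient_left.ae_ne_zero volume (x₀ := (θ₀, X₀)) h₀
  filter_upwards [hμ.ae_le hae] with ω hω T hT
  have hsmooth : ContDiff ℝ 2 (A.loss Real.sigmoid ω.2 y) := by
    have hleft : AnalyticOnNhd ℝ (A.loss Real.sigmoid ω.2 y) univ := fun θ _ =>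
      (hloss (θ, ω.2) (mem_univ _)).comp₂ analyticAt_id analyticAt_const
    exact contDiffOn_univ.1 (hleft.contDiffOn uniqueDiffOn_univ)
  have hnonneg := A.loss_nonneg Real.sigmoid ω.2 y
  obtain ⟨θ, hθ0, hθ⟩ := exists_gradientFlow_Icc hsmooth hnonneg ω.1 hT.le
  refine ⟨θ, ⟨hθ0, hθ⟩, fun θ' hθ' => ?_, ?_⟩
  · exact integralCurve_Icc_unique (contDiff_gradient hsmooth one_add_one_eq_two.le).neg hθ'.2 hθ
      (left_mem_Icc.2 hT.le) (hθ'.1.trans hθ0.symm)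
  · obtain ⟨c, hc, hdecay⟩ :=
      exists_exp_decay_gradientFlow hsmooth hnonneg hT.le hθ (hθ0.symm ▸ hω)
    -- The loss is quadratic in the residual, so the residual decays at half the rate.
    refine ⟨c / 2, half_pos hc, fun t ht => ?_⟩
    have hcl : -2 * (c / 2) * t = -c * t := by ring
    refine ⟨?_, hcl ▸ hdecay t ht⟩
    have h := hdecay t ht
    simp only [PolyNet.loss_eq_norm_sq] at h
    refine (pow_le_pow_iff_left₀ (norm_nonneg _) (by positivity) two_ne_zero).1 ?_
    rw [mul_pow, ← Real.exp_nat_mul]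
    have hexp : ((2 : ℕ) : ℝ) * (-(c / 2) * t) = -c * t := by push_cast; ring
    rw [hexp]
    linarith
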